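/- Let $G$ be a square grid graph, that is, a nonempty finite induced subgraph of a rectangular grid graph in which every node and every edge belongs to a square (a 4-cycle) of $G$. Then $G$ has a good labeling if and only if $G$ is $12$-representable. Here a labeling of $G$ assigns distinct positive integers to the nodes of $G$. A labeling is good if no induced subgraph of the labeled graph becomes, after replacing its $i$-th smallest label by $i$ for each $i$, one of the following labeled graphs: $I_3$, with nodes $1,2,3$ and edges $12,23$; $J_4$, with nodes $1,2,3,4$ and edges $13,24$; $Q_4$, with nodes $1,2,3,4$ and edges $14,23$. The graph $G$ is $12$-representable if it has a labeling and a word $w$ over the positive integers such that the letters occurring in $w$ are exactly the labels of $G$ and, for any two distinct nodes with labels $x<y$, the nodes are non-adjacent if and only if the word obtained from $w$ by deleting all letters other than $x$ and $y$ contains an $x$ immediately followed by a $y$. -/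

import Mathlib

namespace SquareGrid

/-! ### Words over the positive integers, reduction and consecutive patterns -/

/-- The reduction of a word: every occurrence of its `i`-th smallest letter is replaced by `i`. -/
def red (w : List ℕ+) : List ℕ+ :=
  w.map fun a => Nat.succPNat (w.toFinset.filter fun b => b < a).card

/-- `w` contains an occurrence of the consecutive pattern `u`: some block of consecutive letters
of `w` reduces to `u`. -/
def ContainsConsecutive (u w : List ℕ+) : Prop :=
  ∃ s : List ℕ+, s <:+: w ∧ red s = u

/-- The word obtained from `w` by removing all letters that are not in `B`. -/
def restrictTo (w : List ℕ+) (B : Finset ℕ+) : List ℕ+ :=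
  w.filter fun a => a ∈ B

/-! ### Labeled graphs and `u`-representability

A labeling of a graph with vertex type `V` is an injection `ℓ : V ↪ ℕ+`; the labeled graph it
produces has the set of labels `ℓ '' V` as its vertex set. -/

variable {V : Type*}

/-- The word `w` `u`-represents the graph `G` labeled by `ℓ`: the letters of `w` are exactly the
labels, and two distinct vertices are non-adjacent if and only if the restriction of `w` to their
two labels contains the consecutive pattern `u`. -/
def Represents (u w : List ℕ+) (G : SimpleGraph V) (ℓ : V ↪ ℕ+) : Prop :=
  (∀ a : ℕ+, a ∈ w ↔ a ∈ Set.range ℓ) ∧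
    ∀ x y : V, x ≠ y →
      (¬ G.Adj x y ↔ ContainsConsecutive u (restrictTo w {ℓ x, ℓ y}))

/-- An unlabeled graph is `u`-representable if some labeling of it is `u`-represented by a
word. -/
def IsRepresentable (u : List ℕ+) (G : SimpleGraph V) : Prop :=
  ∃ (ℓ : V ↪ ℕ+) (w : List ℕ+), Represents u w G ℓ

/-- `12`-representable graphs. -/
def Is12Representable (G : SimpleGraph V) : Prop :=
  IsRepresentable [1, 2] G

/-! ### Good labelings

A reduced labeled graph with label set `{1, …, k}` is written as a graph on `Fin k`, where `i`
stands for the label `i + 1`. -/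

/-- The path `1 - 2 - 3`. -/
def I₃ : SimpleGraph (Fin 3) := SimpleGraph.fromEdgeSet {s(0, 1), s(1, 2)}

/-- Two disjoint edges `1 - 3` and `2 - 4`. -/
def J₄ : SimpleGraph (Fin 4) := SimpleGraph.fromEdgeSet {s(0, 2), s(1, 3)}

/-- Two disjoint edges `1 - 4` and `2 - 3`. -/
def Q₄ : SimpleGraph (Fin 4) := SimpleGraph.fromEdgeSet {s(0, 3), s(1, 2)}

/-- The graph `G` labeled by `ℓ` has an induced subgraph whose reduced form is `P`: there is an
induced copy `f` of `P` in `G` in which `f i` carries the `(i + 1)`-th smallest of the labels. -/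
def HasInducedReduced {k : ℕ} (P : SimpleGraph (Fin k)) (G : SimpleGraph V) (ℓ : V ↪ ℕ+) : Prop :=
  ∃ f : P ↪g G, StrictMono fun i => ℓ (f i)

/-- A labeling is good if no induced subgraph reduces to `I₃`, `J₄` or `Q₄`. -/
def IsGoodLabeling (G : SimpleGraph V) (ℓ : V ↪ ℕ+) : Prop :=
  ¬ HasInducedReduced I₃ G ℓ ∧ ¬ HasInducedReduced J₄ G ℓ ∧ ¬ HasInducedReduced Q₄ G ℓ

/-! ### Square grid graphs -/

/-- The `m × n` grid graph. -/
def gridGraph (m n : ℕ) : SimpleGraph (Fin m × Fin n) :=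
  SimpleGraph.boxProd (SimpleGraph.pathGraph m) (SimpleGraph.pathGraph n)

/-- `a, b, c, d` are, in cyclic order, the nodes of a square (a 4-cycle) of `G`. In a grid graph
the 4-cycles are exactly the unit squares. -/
def IsSquareOf (G : SimpleGraph V) (a b c d : V) : Prop :=
  G.Adj a b ∧ G.Adj b c ∧ G.Adj c d ∧ G.Adj d a ∧ a ≠ c ∧ b ≠ d

/-- A square grid graph: a (nonempty) induced subgraph of a grid graph that consists of squares,
i.e. every node and every edge belongs to a square. -/
def IsSquareGridGraph (G : SimpleGraph V) : Prop :=
  Nonempty V ∧ (∃ m n : ℕ, Nonempty (G ↪g gridGraph m n)) ∧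
    (∀ a : V, ∃ b c d : V, IsSquareOf G a b c d) ∧
    ∀ a b : V, G.Adj a b → ∃ c d : V, IsSquareOf G a b c d

end SquareGrid

namespace SquareGrid

open scoped List

/-! ### Occurrences of `12` in restricted words -/

/-! The equivalence holds for every finite graph and labeling by labeling; the grid embedding
supplies finiteness. For labels `x < y`, non-adjacency means that `[x, y]` is a subsequence of the
word, i.e. the first `x` precedes the last `y`. Comparing positions then excludes the three
patterns.

Conversely, only first and last occurrences need to be placed. A non-neighbor `x` of `y` with label
at most that of `y` must start before the last `y`, and a smaller neighbor `x'` must start after it;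
this is `ForcedBefore`. In a good labeling these constraints have no cycle (`exists_minimal`), so
first occurrences can be ranked (`exists_rank`). The last `y` is then put as early as its
non-neighbors allow, and the ranking keeps its smaller neighbors after it. -/

theorem red_eq_one_two_iff (s : List ℕ+) : red s = [1, 2] ↔ ∃ a b, a < b ∧ s = [a, b] := by
  constructor
  · intro h
    have hlen : s.length = 2 := by
      have := congrArg List.length h
      simpa [red] using this
    obtain ⟨a, b, rfl⟩ := List.length_eq_two.1 hlen
    refine ⟨a, b, ?_, rfl⟩
    by_contra hab
    have hb : ∀ c ∈ [a, b].toFinset, ¬ c < b := by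
      intro c hc
      simp only [List.toFinset_cons, List.toFinset_nil, insert_empty_eq, Finset.mem_insert,
        Finset.mem_singleton] at hc
      rcases hc with rfl | rfl
      · exact hab
      · exact lt_irrefl _
    simp only [red, List.map_cons, List.map_nil, List.cons.injEq, and_true] at h
    rw [Finset.filter_false_of_mem hb] at h
    exact absurd h.2 (by decide)
  · rintro ⟨a, b, hab, rfl⟩
    have ha : [a, b].toFinset.filter (fun c => c < a) = ∅ := by
      ext c
      simp only [List.toFinset_cons, List.toFinset_nil, insert_empty_eq, Finset.mem_filter,
        Finset.mem_insert, Finset.mem_singleton, Finset.notMem_empty, iff_false]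
      rintro ⟨rfl | rfl, hc⟩
      · exact lt_irrefl _ hc
      · exact lt_asymm hab hc
    have hb : [a, b].toFinset.filter (fun c => c < b) = {a} := by
      ext c
      simp only [List.toFinset_cons, List.toFinset_nil, insert_empty_eq, Finset.mem_filter,
        Finset.mem_insert, Finset.mem_singleton]
      constructor
      · rintro ⟨rfl | rfl, hc⟩
        · rfl
        · exact absurd hc (lt_irrefl _)
      · rintro rfl
        exact ⟨Or.inl rfl, hab⟩
    simp only [red, List.map_cons, List.map_nil, ha, hb]
    rfl

/-- With only two letters available, some step from an `a` to a later `b` must be between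
consecutive letters. -/
theorem pair_infix_of_sublist {α : Type*} {a b : α} (w : List α) (hw : ∀ c ∈ w, c = a ∨ c = b)
    (h : [a, b] <+ w) : [a, b] <:+: w := by
  induction w with
  | nil => simp at h
  | cons c w ih =>
    have hw' : ∀ c ∈ w, c = a ∨ c = b := fun d hd => hw d (List.mem_cons_of_mem _ hd)
    rcases List.sublist_cons_iff.1 h with h | ⟨r, hr, hrw⟩
    · exact (ih hw' h).trans (List.suffix_cons c w).isInfix
    · obtain ⟨rfl, rfl⟩ := List.cons.inj hr
      cases w with
      | nil => simp at hrw
      | cons d w =>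
        rcases hw' d List.mem_cons_self with rfl | rfl
        · by_cases hdb : d = b
          · subst hdb
            exact ⟨[], w, rfl⟩
          · have hb : b ∈ w := by
              have : b ∈ d :: w := List.singleton_sublist.1 hrw
              rcases List.mem_cons.1 this with h | h
              · exact absurd h.symm hdb
              · exact h
            exact (ih hw' ((List.singleton_sublist.2 hb).cons_cons d)).trans
              (List.suffix_cons d _).isInfix
        · exact ⟨[], w, rfl⟩

theorem containsConsecutive_one_two_iff (w : List ℕ+) {x y : ℕ+} (hxy : x < y) :
    ContainsConsecutive [1, 2] (restrictTo w {x, y}) ↔ [x, y] <+ w := by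
  have hmem : ∀ c ∈ restrictTo w {x, y}, c = x ∨ c = y := by
    intro c hc
    simpa using (List.mem_filter.1 hc).2
  constructor
  · rintro ⟨s, hs, hred⟩
    obtain ⟨a, b, hab, rfl⟩ := (red_eq_one_two_iff s).1 hred
    have ha := hmem a (hs.subset (by simp))
    have hb := hmem b (hs.subset (by simp))
    have : a = x ∧ b = y := by
      rcases ha with rfl | rfl <;> rcases hb with rfl | rfl
      · exact absurd hab (lt_irrefl _)
      · exact ⟨rfl, rfl⟩
      · exact absurd hab (lt_asymm hxy)
      · exact absurd hab (lt_irrefl _)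
    obtain ⟨rfl, rfl⟩ := this
    exact hs.sublist.trans List.filter_sublist
  · intro h
    refine ⟨[x, y], pair_infix_of_sublist _ hmem ?_, (red_eq_one_two_iff _).2 ⟨x, y, hxy, rfl⟩⟩
    have := h.filter (fun a => decide (a ∈ ({x, y} : Finset ℕ+)))
    simpa [restrictTo] using this

theorem represents_one_two_iff {V : Type*} (w : List ℕ+) (G : SimpleGraph V) (ℓ : V ↪ ℕ+) :
    Represents [1, 2] w G ℓ ↔ (∀ a : ℕ+, a ∈ w ↔ a ∈ Set.range ℓ) ∧
      ∀ x y : V, ℓ x < ℓ y → (¬ G.Adj x y ↔ [ℓ x, ℓ y] <+ w) := by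
  refine and_congr_right fun _ => ⟨fun h x y hxy => ?_, fun h x y hne => ?_⟩
  · rw [h x y (fun e => hxy.ne (congrArg ℓ e)), containsConsecutive_one_two_iff w hxy]
  · rcases lt_or_gt_of_ne (ℓ.injective.ne hne) with hxy | hxy
    · rw [h x y hxy, containsConsecutive_one_two_iff w hxy]
    · rw [G.adj_comm, h y x hxy, Finset.pair_comm, containsConsecutive_one_two_iff w hxy]

/-! ### Representing words give good labelings -/

theorem pair_sublist_iff_getElem {α : Type*} {a b : α} {w : List α} :
    [a, b] <+ w ↔ ∃ (i j : ℕ) (hi : i < w.length) (hj : j < w.length),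
      i < j ∧ w[i] = a ∧ w[j] = b := by
  constructor
  · intro h
    by_contra hcon
    have hp : w.Pairwise fun c d => ¬ (c = a ∧ d = b) :=
      List.pairwise_iff_getElem.2 fun i j hi hj hij hab => hcon ⟨i, j, hi, hj, hij, hab⟩
    exact List.pairwise_iff_forall_sublist.1 hp h ⟨rfl, rfl⟩
  · rintro ⟨i, j, hi, hj, hij, rfl, rfl⟩
    have hp : w.Pairwise fun c d => [c, d] <+ w :=
      List.pairwise_iff_forall_sublist.2 fun h => h
    exact List.pairwise_iff_getElem.1 hp i j hi hj hij

/-- If this `a` does not precede this `d`, then `c` comes before `d`, which is no later than `a`,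
which comes before `b`. -/
theorem pair_sublist_exchange {α : Type*} {a b c d : α} {w : List α} (h₁ : [a, b] <+ w)
    (h₂ : [c, d] <+ w) : [a, d] <+ w ∨ [c, b] <+ w := by
  obtain ⟨i, j, hi, hj, hij, ha, hb⟩ := pair_sublist_iff_getElem.1 h₁
  obtain ⟨k, m, hk, hm, hkm, hc, hd⟩ := pair_sublist_iff_getElem.1 h₂
  rcases lt_or_ge i m with h | h
  · exact Or.inl (pair_sublist_iff_getElem.2 ⟨i, m, hi, hm, h, ha, hd⟩)
  · exact Or.inr (pair_sublist_iff_getElem.2 ⟨k, j, hk, hj, by omega, hc, hb⟩)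

theorem pair_sublist_of_mem {α : Type*} {a b c : α} {w : List α} (h : [a, c] <+ w)
    (hb : b ∈ w) : [a, b] <+ w ∨ [b, c] <+ w := by
  obtain ⟨i, j, hi, hj, hij, ha, hc⟩ := pair_sublist_iff_getElem.1 h
  obtain ⟨k, hk, hb⟩ := List.getElem_of_mem hb
  rcases lt_or_ge i k with h | h
  · exact Or.inl (pair_sublist_iff_getElem.2 ⟨i, k, hi, hk, h, ha, hb⟩)
  · exact Or.inr (pair_sublist_iff_getElem.2 ⟨k, j, hk, hj, by omega, hb, hc⟩)

theorem Represents.isGoodLabeling {V : Type*} {w : List ℕ+} {G : SimpleGraph V} {ℓ : V ↪ ℕ+}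
    (h : Represents [1, 2] w G ℓ) : IsGoodLabeling G ℓ := by
  obtain ⟨hw, h⟩ := (represents_one_two_iff w G ℓ).1 h
  refine ⟨?_, ?_, ?_⟩
  · rintro ⟨f, hf⟩
    have key : ∀ i j : Fin 3, i < j → (¬ I₃.Adj i j ↔ [ℓ (f i), ℓ (f j)] <+ w) := fun i j hij => by
      rw [← h _ _ (hf hij), f.map_adj_iff]
    rcases pair_sublist_of_mem ((key 0 2 (by decide)).1 (by simp [I₃]))
      ((hw (ℓ (f 1))).2 ⟨_, rfl⟩) with h' | h'
    · exact (key 0 1 (by decide)).2 h' (by simp [I₃])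
    · exact (key 1 2 (by decide)).2 h' (by simp [I₃])
  · rintro ⟨f, hf⟩
    have key : ∀ i j : Fin 4, i < j → (¬ J₄.Adj i j ↔ [ℓ (f i), ℓ (f j)] <+ w) := fun i j hij => by
      rw [← h _ _ (hf hij), f.map_adj_iff]
    rcases pair_sublist_exchange ((key 0 3 (by decide)).1 (by simp [J₄]))
      ((key 1 2 (by decide)).1 (by simp [J₄])) with h' | h'
    · exact (key 0 2 (by decide)).2 h' (by simp [J₄])
    · exact (key 1 3 (by decide)).2 h' (by simp [J₄])
  · rintro ⟨f, hf⟩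
    have key : ∀ i j : Fin 4, i < j → (¬ Q₄.Adj i j ↔ [ℓ (f i), ℓ (f j)] <+ w) := fun i j hij => by
      rw [← h _ _ (hf hij), f.map_adj_iff]
    rcases pair_sublist_exchange ((key 0 2 (by decide)).1 (by simp [Q₄]))
      ((key 1 3 (by decide)).1 (by simp [Q₄])) with h' | h'
    · exact (key 0 3 (by decide)).2 h' (by simp [Q₄])
    · exact (key 1 2 (by decide)).2 h' (by simp [Q₄])

/-! ### Good labelings give representing words -/

theorem hasInducedReduced_of_adj_iff {V : Type*} {k : ℕ} {P : SimpleGraph (Fin k)}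
    {G : SimpleGraph V} {ℓ : V ↪ ℕ+} (f : Fin k → V) (hf : StrictMono fun i => ℓ (f i))
    (h : ∀ i j, i < j → (G.Adj (f i) (f j) ↔ P.Adj i j)) : HasInducedReduced P G ℓ := by
  refine ⟨⟨⟨f, fun i j hij => hf.injective (congrArg ℓ hij)⟩, ?_⟩, hf⟩
  intro i j
  rcases lt_trichotomy i j with hij | rfl | hij
  · exact h i j hij
  · simp
  · rw [G.adj_comm, P.adj_comm]
    exact h j i hij

section Good

variable {V : Type*} {G : SimpleGraph V} {ℓ : V ↪ ℕ+}

theorem IsGoodLabeling.adj_trans (h : IsGoodLabeling G ℓ) {x y z : V} (hxy : ℓ x < ℓ y)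
    (hyz : ℓ y < ℓ z) (axy : G.Adj x y) (ayz : G.Adj y z) : G.Adj x z := by
  by_contra hxz
  refine h.1 (hasInducedReduced_of_adj_iff ![x, y, z] ?_ ?_)
  · refine Fin.strictMono_iff_lt_succ.2 fun i => ?_
    fin_cases i
    · exact hxy
    · exact hyz
  · intro i j hij
    fin_cases i <;> fin_cases j <;> first | exact absurd hij (by decide) | simp [I₃, *]

theorem IsGoodLabeling.not_crossing (h : IsGoodLabeling G ℓ) {a b c d : V} (hab : ℓ a < ℓ b)
    (hbc : ℓ b < ℓ c) (hcd : ℓ c < ℓ d) (nab : ¬ G.Adj a b) (ac : G.Adj a c) (nad : ¬ G.Adj a d)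
    (nbc : ¬ G.Adj b c) (bd : G.Adj b d) (ncd : ¬ G.Adj c d) : False := by
  refine h.2.1 (hasInducedReduced_of_adj_iff ![a, b, c, d] ?_ ?_)
  · refine Fin.strictMono_iff_lt_succ.2 fun i => ?_
    fin_cases i
    · exact hab
    · exact hbc
    · exact hcd
  · intro i j hij
    fin_cases i <;> fin_cases j <;> first | exact absurd hij (by decide) | simp [J₄, *]

theorem IsGoodLabeling.not_nesting (h : IsGoodLabeling G ℓ) {a b c d : V} (hab : ℓ a < ℓ b)
    (hbc : ℓ b < ℓ c) (hcd : ℓ c < ℓ d) (nab : ¬ G.Adj a b) (nac : ¬ G.Adj a c) (ad : G.Adj a d)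
    (bc : G.Adj b c) (nbd : ¬ G.Adj b d) (ncd : ¬ G.Adj c d) : False := by
  refine h.2.2 (hasInducedReduced_of_adj_iff ![a, b, c, d] ?_ ?_)
  · refine Fin.strictMono_iff_lt_succ.2 fun i => ?_
    fin_cases i
    · exact hab
    · exact hbc
    · exact hcd
  · intro i j hij
    fin_cases i <;> fin_cases j <;> first | exact absurd hij (by decide) | simp [Q₄, *]

theorem IsGoodLabeling.no_alternating_square (h : IsGoodLabeling G ℓ) {x₁ x₂ y₁ y₂ : V}
    (hx : ℓ x₁ ≤ ℓ x₂) (n₁₁ : ¬ G.Adj x₁ y₁) (h₂₁ : ℓ x₂ < ℓ y₁)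
    (a₂₁ : G.Adj x₂ y₁) (h₂₂ : ℓ x₂ ≤ ℓ y₂) (n₂₂ : ¬ G.Adj x₂ y₂) (a₁₂ : G.Adj x₁ y₂) :
    False := by
  rcases hx.eq_or_lt with hx | hx
  · exact n₁₁ (ℓ.injective hx ▸ a₂₁)
  have nxx : ¬ G.Adj x₁ x₂ := fun e => n₁₁ (h.adj_trans hx h₂₁ e a₂₁)
  rcases h₂₂.eq_or_lt with h₂₂ | h₂₂
  · exact nxx (ℓ.injective h₂₂ ▸ a₁₂)
  rcases lt_trichotomy (ℓ y₁) (ℓ y₂) with hy | hy | hy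
  · have nyy : ¬ G.Adj y₁ y₂ := fun e => n₂₂ (h.adj_trans h₂₁ hy a₂₁ e)
    exact h.not_nesting hx h₂₁ hy nxx n₁₁ a₁₂ a₂₁ n₂₂ nyy
  · exact n₁₁ (ℓ.injective hy ▸ a₁₂)
  · have nyy : ¬ G.Adj y₂ y₁ := fun e => n₁₁ (h.adj_trans (hx.trans h₂₂) hy a₁₂ e)
    exact h.not_crossing hx h₂₂ hy nxx a₁₂ n₁₁ n₂₂ a₂₁ nyy

/-- The first occurrence of `x` is forced to precede the first occurrence of `x'`: some `y` has
to occur after the former and before the latter. -/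
def ForcedBefore (G : SimpleGraph V) (ℓ : V ↪ ℕ+) (x x' : V) : Prop :=
  ∃ y, ℓ x ≤ ℓ y ∧ ¬ G.Adj x y ∧ ℓ x' < ℓ y ∧ G.Adj x' y

theorem not_forcedBefore_self (x : V) : ¬ ForcedBefore G ℓ x x := by
  rintro ⟨y, -, hn, -, ha⟩
  exact hn ha

/-- The witness for the second constraint serves for the composite, since its adjacency to `x₁`
would close an alternating square. This needs `x₁` to have a label no larger than that of `x₂`, so
acyclicity is argued from a node of smallest label. -/
theorem IsGoodLabeling.forcedBefore_trans (h : IsGoodLabeling G ℓ) {x₁ x₂ x₃ : V}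
    (hx : ℓ x₁ ≤ ℓ x₂) (h₁₂ : ForcedBefore G ℓ x₁ x₂) (h₂₃ : ForcedBefore G ℓ x₂ x₃) :
    ForcedBefore G ℓ x₁ x₃ := by
  obtain ⟨y₁, -, n₁₁, h₂₁, a₂₁⟩ := h₁₂
  obtain ⟨y₂, h₂₂, n₂₂, h₃₂, a₃₂⟩ := h₂₃
  exact ⟨y₂, hx.trans h₂₂,
    fun a₁₂ => h.no_alternating_square hx n₁₁ h₂₁ a₂₁ h₂₂ n₂₂ a₁₂, h₃₂, a₃₂⟩

theorem IsGoodLabeling.exists_minimal (h : IsGoodLabeling G ℓ) (T : Finset V)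
    (hT : T.Nonempty) : ∃ x ∈ T, ∀ z ∈ T, ¬ ForcedBefore G ℓ z x := by
  classical
  induction T using Finset.strongInduction with
  | H T ih =>
    obtain ⟨m, hm, hmin⟩ := T.exists_min_image ℓ hT
    -- Discard `m` and everything it is forced before. A predecessor of a surviving node cannot have
    -- been discarded: a chain starting at `m` composes, so the survivor would be discarded too.
    have hss : (T.erase m).filter (fun t => ¬ ForcedBefore G ℓ m t) ⊂ T :=
      (Finset.filter_subset _ _).trans_ssubset (Finset.erase_ssubset hm)
    by_cases hne : ((T.erase m).filter (fun t => ¬ ForcedBefore G ℓ m t)).Nonempty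
    · obtain ⟨x, hx, hxmin⟩ := ih _ hss hne
      rw [Finset.mem_filter, Finset.mem_erase] at hx
      refine ⟨x, hx.1.2, fun z hz hzx => ?_⟩
      by_cases hmz : ForcedBefore G ℓ m z
      · exact hx.2 (h.forcedBefore_trans (hmin z hz) hmz hzx)
      · rcases eq_or_ne z m with rfl | hzm
        · exact hx.2 hzx
        · exact hxmin z (Finset.mem_filter.2 ⟨Finset.mem_erase.2 ⟨hzm, hz⟩, hmz⟩) hzx
    · refine ⟨m, hm, fun z hz hzm => ?_⟩
      rcases eq_or_ne z m with rfl | hne'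
      · exact not_forcedBefore_self _ hzm
      · refine hne ⟨z, Finset.mem_filter.2 ⟨Finset.mem_erase.2 ⟨hne', hz⟩, fun hmz => ?_⟩⟩
        exact not_forcedBefore_self m (h.forcedBefore_trans (hmin z hz) hmz hzm)

theorem IsGoodLabeling.exists_rank (h : IsGoodLabeling G ℓ) (T : Finset V) :
    ∃ r : V → ℕ, ∀ x ∈ T, ∀ x' ∈ T, ForcedBefore G ℓ x x' → r x < r x' := by
  classical
  induction T using Finset.strongInduction with
  | H T ih =>
    rcases T.eq_empty_or_nonempty with rfl | hT
    · exact ⟨fun _ => 0, by simp⟩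
    obtain ⟨m, hm, hmin⟩ := h.exists_minimal T hT
    obtain ⟨r, hr⟩ := ih _ (Finset.erase_ssubset hm)
    refine ⟨fun x => if x = m then 0 else r x + 1, fun x hx x' hx' hxx => ?_⟩
    have hx'm : x' ≠ m := by
      rintro rfl
      exact hmin x hx hxx
    rcases eq_or_ne x m with rfl | hxm
    · simp [hx'm]
    · simpa [hx'm, hxm] using
        hr x (Finset.mem_erase.2 ⟨hxm, hx⟩) x' (Finset.mem_erase.2 ⟨hx'm, hx'⟩) hxx

/-- A word in which the first occurrence of `ℓ x` has height `f x` and the last one height `l x`,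
where first occurrences precede last occurrences of the same height. -/
theorem exists_word_of_heights [Finite V] (ℓ : V ↪ ℕ+) (f l : V → ℕ) (hfl : ∀ x, f x ≤ l x) :
    ∃ w : List ℕ+, (∀ a, a ∈ w ↔ a ∈ Set.range ℓ) ∧
      ∀ x y, x ≠ y → ([ℓ x, ℓ y] <+ w ↔ f x ≤ l y) := by
  classical
  have := Fintype.ofFinite V
  set A : ℕ → List ℕ+ := fun i => ((Finset.univ.filter fun x => f x = i).map ℓ).toList with hA
  set B : ℕ → List ℕ+ := fun i => ((Finset.univ.filter fun x => l x = i).map ℓ).toList with hB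
  have memA : ∀ x i, ℓ x ∈ A i ↔ f x = i := by simp [hA]
  have memB : ∀ x i, ℓ x ∈ B i ↔ l x = i := by simp [hB]
  have memAB : ∀ x i, ℓ x ∈ A i ++ B i → f x ≤ i ∧ i ≤ l x := by
    intro x i hx
    have := hfl x
    rcases List.mem_append.1 hx with hx | hx
    · have := (memA x i).1 hx
      omega
    · have := (memB x i).1 hx
      omega
  set N := Finset.univ.sup l + 1 with hN
  have hlN : ∀ x, l x < N := fun x => Nat.lt_succ_of_le (Finset.le_sup (Finset.mem_univ x))
  refine ⟨(List.range N).flatMap fun i => A i ++ B i, fun a => ⟨fun ha => ?_, ?_⟩,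
    fun x y hxy => ⟨fun hs => ?_, fun hle => ?_⟩⟩
  · obtain ⟨i, -, hi⟩ := List.mem_flatMap.1 ha
    rcases List.mem_append.1 hi with hi | hi
    · obtain ⟨x, -, rfl⟩ := Finset.mem_map.1 (Finset.mem_toList.1 hi)
      exact ⟨x, rfl⟩
    · obtain ⟨x, -, rfl⟩ := Finset.mem_map.1 (Finset.mem_toList.1 hi)
      exact ⟨x, rfl⟩
  · rintro ⟨x, rfl⟩
    exact List.mem_flatMap.2 ⟨l x, List.mem_range.2 (hlN x),
      List.mem_append_right _ ((memB x _).2 rfl)⟩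
  · have hp : ((List.range N).flatMap fun i => A i ++ B i).Pairwise
        fun a b => ∃ i j, i ≤ j ∧ a ∈ A i ++ B i ∧ b ∈ A j ++ B j := by
      refine List.pairwise_flatMap.2 ⟨fun i _ => ?_, ?_⟩
      · exact List.pairwise_iff_forall_sublist.2 fun {a b} h =>
          ⟨i, i, le_rfl, h.subset (by simp), h.subset (by simp)⟩
      · exact List.pairwise_lt_range.imp fun {i j} hij a ha b hb => ⟨i, j, hij.le, ha, hb⟩
    obtain ⟨i, j, hij, hi, hj⟩ := List.pairwise_iff_forall_sublist.1 hp hs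
    exact (memAB x i hi).1.trans (hij.trans (memAB y j hj).2)
  · have ha := (memA x _).2 rfl
    have hb := (memB y _).2 rfl
    rcases hle.eq_or_lt with he | hlt
    -- At equal heights the order inside a block, `A` before `B`, decides.
    · rw [← he] at hb
      have h₁ : [ℓ x] ++ [ℓ y] <+ A (f x) ++ B (f x) :=
        (List.singleton_sublist.2 ha).append (List.singleton_sublist.2 hb)
      refine h₁.trans (List.sublist_flatten_of_mem (List.mem_map.2 ⟨f x, ?_, rfl⟩))
      exact List.mem_range.2 (he ▸ hlN y)
    · have h₁ : [f x, l y] <+ List.range N :=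
        pair_sublist_iff_getElem.2 ⟨f x, l y, by simpa using hlt.trans (hlN y),
          by simpa using hlN y, hlt, by simp, by simp⟩
      have h₂ := h₁.flatMap (fun i => A i ++ B i)
      refine List.Sublist.trans ?_ h₂
      have h₃ : [ℓ x] ++ [ℓ y] <+ (A (f x) ++ B (f x)) ++ (A (l y) ++ B (l y)) :=
        (List.singleton_sublist.2 (List.mem_append_left _ ha)).append
          (List.singleton_sublist.2 (List.mem_append_right _ hb))
      simpa using h₃

theorem IsGoodLabeling.exists_represents [Finite V] (h : IsGoodLabeling G ℓ) :
    ∃ w, Represents [1, 2] w G ℓ := by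
  classical
  have := Fintype.ofFinite V
  obtain ⟨r, hr⟩ := h.exists_rank Finset.univ
  set l : V → ℕ := fun y => (Finset.univ.filter fun x => ℓ x ≤ ℓ y ∧ ¬ G.Adj x y).sup r with hl
  have hle : ∀ x y, ℓ x ≤ ℓ y → ¬ G.Adj x y → r x ≤ l y := fun x y hxy hn =>
    Finset.le_sup (f := r) (Finset.mem_filter.2 ⟨Finset.mem_univ x, hxy, hn⟩)
  obtain ⟨w, hw, hsub⟩ := exists_word_of_heights ℓ r l fun x => hle x x le_rfl G.irrefl
  refine ⟨w, (represents_one_two_iff w G ℓ).2 ⟨hw, fun x y hxy => ?_⟩⟩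
  rw [hsub x y fun e => hxy.ne (congrArg ℓ e)]
  refine ⟨hle x y hxy.le, fun hxl ha => ?_⟩
  -- The set contains `y` itself, so the supremum is attained at some `z`; then `y` witnesses that
  -- `z` is forced before its neighbor `x`.
  obtain ⟨z, hz, hzl⟩ := Finset.exists_mem_eq_sup
    (Finset.univ.filter fun x => ℓ x ≤ ℓ y ∧ ¬ G.Adj x y) ⟨y, by simp⟩ r
  rw [Finset.mem_filter] at hz
  have hlt := hr z (Finset.mem_univ z) x (Finset.mem_univ x) ⟨y, hz.2.1, hz.2.2, hxy, ha⟩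
  have : l y = r z := hzl
  omega

end Good

/-- A finite graph has a good labeling if and only if it is `12`-representable. -/
theorem exists_isGoodLabeling_iff {V : Type*} [Finite V] (G : SimpleGraph V) :
    (∃ ℓ : V ↪ ℕ+, IsGoodLabeling G ℓ) ↔ Is12Representable G :=
  ⟨fun ⟨ℓ, h⟩ => ⟨ℓ, h.exists_represents⟩, fun ⟨ℓ, _, h⟩ => ⟨ℓ, h.isGoodLabeling⟩⟩

end SquareGrid

theorem corollary2p13 {V : Type*} (G : SimpleGraph V) (hG : SquareGrid.IsSquareGridGraph G) :
    (∃ ℓ : V ↪ ℕ+, SquareGrid.IsGoodLabeling G ℓ) ↔ SquareGrid.Is12Representable G := by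
  obtain ⟨-, ⟨m, n, ⟨e⟩⟩, -⟩ := hG
  have : Finite V := Finite.of_injective e e.injective
  exact SquareGrid.exists_isGoodLabeling_iff G
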